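/- **Setting.** A domain $\Omega$ is a planar straight line graph (PSLG): a finite set of vertices in $\mathbb R^2$ and a finite set of non-degenerate segments joining vertices, such that no vertex lies in the relative interior of a segment and two distinct segments meet only in common endpoints. It is assumed that any two adjacent segments make an angle of at least $\pi/2$. Fix $\beta\ge\sqrt2$. A point *encroaches* a segment if it lies strictly inside its diametral circle. A mesh is a vertex set together with the current (sub)segments; its triangles are all triangles on the vertices whose circumcircle has no vertex strictly inside. A triangle is *poorly shaped* if the ratio of its circumradius to the length of its shortest side (Ruppert's notion), respectively to the length of the shortest edge of the current Delaunay triangulation (Chew's notion), exceeds $\beta$; one of the two notions is fixed throughout. For a mesh let $\mathcal B$ (resp. $\mathcal C$) be the set of circumcircles of poorly shaped triangles whose centers encroach some segment (resp. no segment), and $\mathcal D_T$ the set of segments encroached by a mesh vertex. Inserting the midpoint of a segment replaces the segment by its two halves. **Sequential refinement.** Start with a domain. At each iteration insert one candidate: the center of a circle of $\mathcal C$, or the midpoint of a segment of $\mathcal D_T\cup\mathcal D_{\mathcal B}$, where $\mathcal D_{\mathcal B}$ is built incrementally: every segment encroached by the center of a circle of the current $\mathcal B$ joins $\mathcal D_{\mathcal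 B}$ and remains in it until it is split. An execution may end only at a mesh with $\mathcal C\cup\mathcal D_T\cup\mathcal B=\emptyset$ (at such a mesh it may either end or go on with the remaining candidates of $\mathcal D_{\mathcal B}$). The mesh at which it ends is its output. **Generic parallel refinement.** *Preprocessing:* as long as there are segments whose closed diametral disk meets a vertex or a segment not incident to them, split all such segments simultaneously at their midpoints; let $\Omega'$ be the resulting domain. *Loop, started at* $\Omega'$: choose an independent subset $\mathcal{BC}$ of $\mathcal B\cup\mathcal C$, non-empty unless $\mathcal B\cup\mathcal C$ is empty; let $\mathcal D$ be the set of segments encroached by centers of circles of $\mathcal{BC}$; stop if $(\mathcal{BC}\cap\mathcal C)\cup\mathcal D=\emptyset$; otherwise choose an independent subset of $(\mathcal{BC}\cap\mathcal C)\cup\mathcal D$, insert all the corresponding circumcenters and midpoints simultaneously, and repeat. Here two circumcircles are independent unless each contains the center of the other strictly inside; a circumcircle $c$ and a segment $d$ are independent unless the midpoint of $d$ is strictly inside $c$ and the radius of $c$ is less than $\sqrt2$ times the radius of the diametral circle of $d$; two segments are always independent. **Theorem.** Let $\Omega$ be such a domain, and let $M$ be a mesh produced by some (finite) execution of the generic parallel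 algorithm on $\Omega$, with preprocessed domain $\Omega'$. Then $M$ is the output of some execution of the sequential algorithm, with the same notion of poorly shaped triangle and the same $\beta$, on $\Omega'$. In particular, $M$ has no poorly shaped triangle and no segment of $M$ is encroached by a vertex of $M$. -/

import Mathlib

noncomputable section

namespace DelaunayRefinement

/-- The Euclidean plane. -/
abbrev Plane : Type := EuclideanSpace ℝ (Fin 2)

/-! ### Segments and their diametral circles

A segment is the unordered pair of its endpoints. -/

/-- The midpoint of a segment (the center of its diametral circle). -/
def segMid : Sym2 Plane → Plane :=
  Sym2.lift ⟨fun a b => midpoint ℝ a b, fun a b => midpoint_comm a b⟩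

/-- Half the length of a segment (the radius of its diametral circle). -/
def segRad : Sym2 Plane → ℝ :=
  Sym2.lift ⟨fun a b => dist a b / 2, fun a b => by simp only [dist_comm a b]⟩

/-- The points of the (closed) segment. -/
def segCarrier : Sym2 Plane → Set Plane :=
  Sym2.lift ⟨fun a b => segment ℝ a b, fun a b => segment_symm ℝ a b⟩

@[simp] theorem segMid_mk (a b : Plane) : segMid s(a, b) = midpoint ℝ a b := rfl

@[simp] theorem segRad_mk (a b : Plane) : segRad s(a, b) = dist a b / 2 := rfl

@[simp] theorem segCarrier_mk (a b : Plane) : segCarrier s(a, b) = segment ℝ a b := rfl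

/-- A point encroaches a segment if it is inside the diametral circle of the segment. -/
def Encroaches (p : Plane) (s : Sym2 Plane) : Prop :=
  dist p (segMid s) < segRad s

/-- Two segments are incident if they share an endpoint. -/
def Incident (s t : Sym2 Plane) : Prop :=
  ∃ v, v ∈ s ∧ v ∈ t

/-! ### Domains and meshes

The same data describe an input domain and a mesh at any stage of refinement: the current vertices
and the current (sub)segments of the boundary.  The triangulation itself is the Delaunay
triangulation of the vertices, hence is determined by them. -/

/-- A finite set of vertices with a set of straight boundary segments. -/
@[ext] structure PlanarGraph where
  verts : Set Plane
  segs : Set (Sym2 Plane)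

/-- A planar straight line graph: finitely many vertices and nondegenerate segments between
vertices; no vertex lies in the relative interior of a segment, and distinct segments meet only in
common endpoints. -/
structure PlanarGraph.IsPSLG (G : PlanarGraph) : Prop where
  finite_verts : G.verts.Finite
  finite_segs : G.segs.Finite
  ends_mem : ∀ s ∈ G.segs, ∀ v ∈ s, v ∈ G.verts
  not_diag : ∀ s ∈ G.segs, ¬ s.IsDiag
  vert_on_seg : ∀ s ∈ G.segs, ∀ v ∈ G.verts, v ∈ segCarrier s → v ∈ s
  seg_inter : ∀ s ∈ G.segs, ∀ t ∈ G.segs, s ≠ t →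
    ∀ x, x ∈ segCarrier s → x ∈ segCarrier t → x ∈ s ∧ x ∈ t

/-- The angle between any two adjacent segments is at least `π / 2`. -/
def PlanarGraph.RightAngled (G : PlanarGraph) : Prop :=
  ∀ v a b : Plane, s(v, a) ∈ G.segs → s(v, b) ∈ G.segs → a ≠ b →
    Real.pi / 2 ≤ EuclideanGeometry.angle a v b

/-- A circle, given by its center and radius. -/
@[ext] structure Circ where
  center : Plane
  radius : ℝ

/-- Simultaneous insertion of the centers of the circles in `I` and of the midpoints of the
segments in `S`.  Every segment of `S` is replaced by the two segments from its midpoint to its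
endpoints (both halves occur below, since `s(a, b) = s(b, a)`). -/
def PlanarGraph.insert (G : PlanarGraph) (I : Set Circ) (S : Set (Sym2 Plane)) :
    PlanarGraph where
  verts := G.verts ∪ Circ.center '' I ∪ segMid '' S
  segs := (G.segs \ S) ∪ {t | ∃ a b, s(a, b) ∈ S ∧ t = s(a, midpoint ℝ a b)}

/-! ### Delaunay triangulation and poorly shaped triangles -/

/-- `t` is a triangle of the Delaunay triangulation of `P`: its vertices belong to `P` and no point
of `P` is inside its circumcircle. -/
def IsDelaunayTriangle (P : Set Plane) (t : Affine.Triangle ℝ Plane) : Prop :=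
  (∀ i, t.points i ∈ P) ∧ ∀ x ∈ P, ¬ dist x t.circumcenter < t.circumradius

/-- `p q` is an edge of the Delaunay triangulation of `P`: some circle through `p` and `q` has no
point of `P` inside. -/
def IsDelaunayEdge (P : Set Plane) (p q : Plane) : Prop :=
  p ∈ P ∧ q ∈ P ∧ p ≠ q ∧ ∃ o : Plane, dist p o = dist q o ∧ ∀ x ∈ P, ¬ dist x o < dist p o

/-- The two notions of a poorly shaped triangle. -/
inductive Quality where
  | ruppert
  | chew

/-- A triangle is poorly shaped with respect to the threshold `β` if the ratio of its circumradius
to the length of its shortest side (Ruppert), respectively to the length of the shortest edge of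
the current Delaunay triangulation (Chew), is larger than `β`. -/
def Poor (q : Quality) (β : ℝ) (P : Set Plane) (t : Affine.Triangle ℝ Plane) : Prop :=
  match q with
  | Quality.ruppert => ∃ i j, i ≠ j ∧ β < t.circumradius / dist (t.points i) (t.points j)
  | Quality.chew => ∃ x y, IsDelaunayEdge P x y ∧ β < t.circumradius / dist x y

/-! ### Candidates -/

/-- The circumcircles of the poorly shaped Delaunay triangles. -/
def poorCircles (q : Quality) (β : ℝ) (G : PlanarGraph) : Set Circ :=
  {c | ∃ t, IsDelaunayTriangle G.verts t ∧ Poor q β G.verts t ∧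
    c = ⟨t.circumcenter, t.circumradius⟩}

/-- The set `𝓑`: circumcircles of poorly shaped triangles whose centers encroach some segment. -/
def setB (q : Quality) (β : ℝ) (G : PlanarGraph) : Set Circ :=
  {c | c ∈ poorCircles q β G ∧ ∃ s ∈ G.segs, Encroaches c.center s}

/-- The set `𝓒`: circumcircles of poorly shaped triangles whose centers encroach no segment. -/
def setC (q : Quality) (β : ℝ) (G : PlanarGraph) : Set Circ :=
  {c | c ∈ poorCircles q β G ∧ ¬ ∃ s ∈ G.segs, Encroaches c.center s}

/-- The set `𝓓_T`: segments encroached by a vertex of the current mesh. -/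
def setDT (G : PlanarGraph) : Set (Sym2 Plane) :=
  {s | s ∈ G.segs ∧ ∃ p ∈ G.verts, Encroaches p s}

/-- The segments encroached by the center of some circle of `X`. -/
def encroachedBy (G : PlanarGraph) (X : Set Circ) : Set (Sym2 Plane) :=
  {s | s ∈ G.segs ∧ ∃ c ∈ X, Encroaches c.center s}

/-! ### Sequential Delaunay refinement -/

/-- `SequentialState q β Ω G D`: the sequential algorithm, started on the domain `Ω`, can reach the
mesh `G` with `𝓓_𝓑 = D`.  One point is inserted per iteration, chosen among the centers of `𝓒` and
the midpoints of the segments of `𝓓_T ∪ 𝓓_𝓑`.  The set `𝓓_𝓑` is built incrementally: a segment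
encroached by a center of `𝓑` enters `𝓓_𝓑` and stays there as long as it is a segment of the
mesh. -/
inductive SequentialState (q : Quality) (β : ℝ) (Ω : PlanarGraph) :
    PlanarGraph → Set (Sym2 Plane) → Prop
  | start : SequentialState q β Ω Ω (encroachedBy Ω (setB q β Ω))
  | insertCenter {G G' : PlanarGraph} {D : Set (Sym2 Plane)} {c : Circ}
      (h : SequentialState q β Ω G D) (hc : c ∈ setC q β G) (hG' : G' = G.insert {c} ∅) :
      SequentialState q β Ω G' ((D ∩ G'.segs) ∪ encroachedBy G' (setB q β G'))
  | insertMidpoint {G G' : PlanarGraph} {D : Set (Sym2 Plane)} {s : Sym2 Plane}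
      (h : SequentialState q β Ω G D) (hs : s ∈ setDT G ∪ D) (hG' : G' = G.insert ∅ {s}) :
      SequentialState q β Ω G' ((D ∩ G'.segs) ∪ encroachedBy G' (setB q β G'))

/-- `M` is the output of some execution of the sequential algorithm on `Ω`: a reachable mesh at
which `𝓒 ∪ 𝓓_T ∪ 𝓑` is empty. -/
def IsSequentialOutput (q : Quality) (β : ℝ) (Ω M : PlanarGraph) : Prop :=
  (∃ D, SequentialState q β Ω M D) ∧
    setC q β M = ∅ ∧ setDT M = ∅ ∧ setB q β M = ∅

/-! ### Parallel boundary preprocessing -/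

/-- The set `𝓖` of segments whose diametral circle (with its interior) meets an input feature, that
is a vertex or a segment, not incident to the segment. -/
def badSegs (G : PlanarGraph) : Set (Sym2 Plane) :=
  {s | s ∈ G.segs ∧
    ((∃ v ∈ G.verts, v ∉ s ∧ v ∈ Metric.closedBall (segMid s) (segRad s)) ∨
      ∃ t ∈ G.segs, ¬ Incident s t ∧
        (segCarrier t ∩ Metric.closedBall (segMid s) (segRad s)).Nonempty)}

/-- The domains reached by splitting, in each round, all the segments of `𝓖` at their midpoints as
long as `𝓖` is not empty. -/
inductive PreprocessingState (Ω : PlanarGraph) : PlanarGraph → Prop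
  | start : PreprocessingState Ω Ω
  | split {G : PlanarGraph} (h : PreprocessingState Ω G) (hG : (badSegs G).Nonempty) :
      PreprocessingState Ω (G.insert ∅ (badSegs G))

/-- `Ω'` is the domain that parallel boundary preprocessing returns on the input `Ω`. -/
def IsPreprocessingOutput (Ω Ω' : PlanarGraph) : Prop :=
  PreprocessingState Ω Ω' ∧ badSegs Ω' = ∅

/-! ### Generic parallel Delaunay refinement -/

/-- Two circumcircles conflict if each contains the center of the other inside. -/
def Conflict (c d : Circ) : Prop :=
  dist c.center d.center < c.radius ∧ dist c.center d.center < d.radius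

/-- A circumcircle `c` and the diametral circle of `s` conflict if the midpoint of `s` is inside
`c` and the radius of `c` is smaller than `√2` times the radius of the diametral circle. -/
def DiametralConflict (c : Circ) (s : Sym2 Plane) : Prop :=
  dist (segMid s) c.center < c.radius ∧ c.radius < √2 * segRad s

/-- `X` may be chosen as the set `𝓑𝓒`: an independent subset of `𝓑 ∪ 𝓒`, which is not empty unless
`𝓑 ∪ 𝓒` is. -/
structure IsChoiceBC (q : Quality) (β : ℝ) (G : PlanarGraph) (X : Set Circ) : Prop where
  subset : X ⊆ setB q β G ∪ setC q β G
  independent : X.Pairwise fun c d => ¬ Conflict c d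
  nonempty : (setB q β G ∪ setC q β G).Nonempty → X.Nonempty

/-- The circles of `I` and the diametral circles of the segments of `S` form an independent subset
of `(𝓑𝓒 ∩ 𝓒) ∪ 𝓓`, where `𝓑𝓒 = X` and `𝓓` consists of the diametral circles encroached by the
centers in `𝓑𝓒`.  Two diametral circles always count as independent. -/
structure IsIndependentChoice (q : Quality) (β : ℝ) (G : PlanarGraph) (X : Set Circ)
    (I : Set Circ) (S : Set (Sym2 Plane)) : Prop where
  centers_subset : I ⊆ X ∩ setC q β G
  segs_subset : S ⊆ encroachedBy G X
  independent : I.Pairwise fun c d => ¬ Conflict c d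
  independent_diametral : ∀ c ∈ I, ∀ s ∈ S, ¬ DiametralConflict c s

/-- `ParallelState q β Ω G`: the loop of the generic parallel algorithm, started on the
(preprocessed) domain `Ω`, can reach the mesh `G`.  In each iteration an independent set of
candidates is inserted in parallel. -/
inductive ParallelState (q : Quality) (β : ℝ) (Ω : PlanarGraph) : PlanarGraph → Prop
  | start : ParallelState q β Ω Ω
  | round {G : PlanarGraph} {X I : Set Circ} {S : Set (Sym2 Plane)}
      (h : ParallelState q β Ω G) (hX : IsChoiceBC q β G X)
      (hguard : (X ∩ setC q β G).Nonempty ∨ (encroachedBy G X).Nonempty)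
      (hI : IsIndependentChoice q β G X I S) :
      ParallelState q β Ω (G.insert I S)

/-- `M` is a mesh produced by some execution of the generic parallel algorithm on the input `Ω`
whose preprocessing step returns `Ω'`: the loop, started on `Ω'`, stops at `M` because
`(𝓑𝓒 ∩ 𝓒) ∪ 𝓓` is empty. -/
def IsParallelOutput (q : Quality) (β : ℝ) (Ω Ω' M : PlanarGraph) : Prop :=
  IsPreprocessingOutput Ω Ω' ∧ ParallelState q β Ω' M ∧
    ∃ X, IsChoiceBC q β M X ∧ X ∩ setC q β M = ∅ ∧ encroachedBy M X = ∅

end DelaunayRefinement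

end

open DelaunayRefinement

namespace DelaunayRefinement

/-! ### Diametral disks and halves of segments -/

/-! Preprocessing makes the domain `WellSeparated`: empty `badSegs` handles non-incident features,
the angle condition handles incident segments. Every parallel round preserves this
(`PlanarGraph.WellSeparated.insert`): inserted circumcenters encroach nothing, midpoints lie on
segments, and the diametral disk of a half lies in that of its parent. Hence no vertex ever
encroaches a segment.

A round is replayed sequentially, all circumcenters before all midpoints. The centers go by
decreasing radius (`SequentialState.insert_centers`): if an earlier center lay inside a later,
smaller circle, each circle would contain the other's center, against independence. So each circle
is still empty when its turn comes; its triangle is still poorly shaped (`Poor.mono`), and its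
center still encroaches nothing, as no segment has changed. The segments to split are in `𝓓_𝓑` when
the round starts and persist there until split (`SequentialState.insert_midpoints`).

At the stopping mesh, a poor circle would force a non-empty choice and hence a candidate
(`IsChoiceBC.poorCircles_eq_empty`). -/

theorem encroaches_mk_iff (p a b : Plane) :
    Encroaches p s(a, b) ↔ inner ℝ (p - a) (p - b) < 0 := by
  have h1 : p - midpoint ℝ a b = (2⁻¹ : ℝ) • ((p - a) + (p - b)) := by
    rw [midpoint_eq_smul_add, invOf_eq_inv]; module
  have h2 : a - b = (p - b) - (p - a) := by abel
  rw [Encroaches, segMid_mk, segRad_mk, dist_eq_norm, dist_eq_norm, h1, h2, norm_smul]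
  -- Thales' theorem by polarization: `‖u + v‖ < ‖u - v‖` exactly when the inner product of `u` and
  -- `v` is negative.
  have h3 := norm_add_sq_real (p - a) (p - b)
  have h4 := norm_sub_sq_real (p - b) (p - a)
  rw [real_inner_comm] at h4
  have h5 : ‖(2⁻¹ : ℝ)‖ * ‖(p - a) + (p - b)‖ < ‖(p - b) - (p - a)‖ / 2 ↔
      ‖(p - a) + (p - b)‖ < ‖(p - b) - (p - a)‖ := by
    rw [Real.norm_of_nonneg (by norm_num)]
    constructor <;> intro h <;> linarith
  rw [h5, ← sq_lt_sq₀ (norm_nonneg _) (norm_nonneg _)]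
  constructor <;> intro h <;> linarith

theorem not_encroaches_of_mem {v : Plane} {s : Sym2 Plane} (hv : v ∈ s) : ¬ Encroaches v s := by
  induction s with
  | _ a b => rcases Sym2.mem_iff.1 hv with rfl | rfl <;> simp [encroaches_mk_iff]

/-- `t` is one of the two halves of `s`. -/
def IsHalf (t s : Sym2 Plane) : Prop :=
  ∃ a b, s = s(a, b) ∧ t = s(a, midpoint ℝ a b)

theorem IsHalf.segRad_eq {t s : Sym2 Plane} (h : IsHalf t s) : segRad t = segRad s / 2 := by
  obtain ⟨a, b, rfl, rfl⟩ := h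
  rw [segRad_mk, segRad_mk, dist_left_midpoint]
  norm_num
  ring

theorem IsHalf.segCarrier_subset {t s : Sym2 Plane} (h : IsHalf t s) :
    segCarrier t ⊆ segCarrier s := by
  obtain ⟨a, b, rfl, rfl⟩ := h
  exact (convex_segment a b).segment_subset (left_mem_segment ℝ a b) (midpoint_mem_segment a b)

theorem IsHalf.dist_segMid {t s : Sym2 Plane} (h : IsHalf t s) :
    dist (segMid t) (segMid s) = segRad s / 2 := by
  obtain ⟨a, b, rfl, rfl⟩ := h
  rw [segMid_mk, segMid_mk, segRad_mk, dist_midpoint_right, dist_left_midpoint]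
  norm_num
  ring

/-- The two disks are internally tangent: center distance and smaller radius are both half the
larger radius. -/
theorem IsHalf.encroaches {t s : Sym2 Plane} (h : IsHalf t s) {p : Plane} (hp : Encroaches p t) :
    Encroaches p s := by
  have h1 := dist_triangle p (segMid t) (segMid s)
  rw [Encroaches, h.segRad_eq] at hp
  rw [h.dist_segMid] at h1
  rw [Encroaches]
  linarith

theorem IsHalf.mem_of_mem_segCarrier {t s : Sym2 Plane} (h : IsHalf t s) {x : Plane}
    (hx : x ∈ s) (hxt : x ∈ segCarrier t) : x ∈ t := by
  obtain ⟨a, b, rfl, rfl⟩ := h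
  rcases Sym2.mem_iff.1 hx with rfl | rfl
  · exact Sym2.mem_mk_left _ _
  · rw [segCarrier_mk, mem_segment_iff_wbtw] at hxt
    -- The far endpoint and the midpoint each lie between `a` and the other, so they coincide; the
    -- segment is then degenerate, a case not excluded here.
    exact Sym2.mem_iff.2 (Or.inr ((wbtw_swap_right_iff ℝ a).1 ⟨hxt, wbtw_midpoint ℝ a x⟩))

/-- Distinct halves of a segment are the two subsegments at its midpoint. -/
theorem IsHalf.opposite {t t' s : Sym2 Plane} (h : IsHalf t s) (h' : IsHalf t' s) (hne : t ≠ t') :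
    ∃ a b, t = s(a, midpoint ℝ a b) ∧ t' = s(midpoint ℝ a b, b) := by
  obtain ⟨a, b, rfl, rfl⟩ := h
  obtain ⟨a', b', hs, rfl⟩ := h'
  rcases Sym2.eq_iff.1 hs with ⟨rfl, rfl⟩ | ⟨rfl, rfl⟩
  · exact absurd rfl hne
  · exact ⟨a, b, rfl, by rw [Sym2.eq_swap, midpoint_comm]⟩

theorem IsHalf.not_encroaches {t t' s : Sym2 Plane} (h : IsHalf t s) (h' : IsHalf t' s)
    (hne : t ≠ t') {x : Plane} (hx : x ∈ segCarrier t') : ¬ Encroaches x t := by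
  obtain ⟨a, b, rfl, rfl⟩ := h.opposite h' hne
  rw [segCarrier_mk, segment_eq_image'] at hx
  obtain ⟨r, ⟨hr, -⟩, rfl⟩ := hx
  rw [encroaches_mk_iff, not_lt]
  have h1 : midpoint ℝ a b + r • (b - midpoint ℝ a b) - a = ((1 + r) / 2) • (b - a) := by
    rw [midpoint_eq_smul_add, invOf_eq_inv]; module
  have h2 : midpoint ℝ a b + r • (b - midpoint ℝ a b) - midpoint ℝ a b = (r / 2) • (b - a) := by
    rw [midpoint_eq_smul_add, invOf_eq_inv]; module
  simp only [h1, h2, real_inner_smul_left, real_inner_smul_right, real_inner_self_eq_norm_sq]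
  positivity

theorem IsHalf.mem_of_mem_segCarrier_opposite {t t' s : Sym2 Plane} (h : IsHalf t s)
    (h' : IsHalf t' s) (hne : t ≠ t') {x : Plane} (hx : x ∈ segCarrier t)
    (hx' : x ∈ segCarrier t') : x ∈ t ∧ x ∈ t' := by
  obtain ⟨a, b, rfl, rfl⟩ := h.opposite h' hne
  rw [segCarrier_mk, mem_segment_iff_wbtw] at hx hx'
  have h1 : Wbtw ℝ a (midpoint ℝ a b) x := (wbtw_midpoint ℝ a b).trans_right_left hx'
  rw [(wbtw_swap_right_iff ℝ a).1 ⟨hx, h1⟩]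
  simp

theorem segMid_mem_segCarrier (s : Sym2 Plane) : segMid s ∈ segCarrier s := by
  induction s with
  | _ a b => exact midpoint_mem_segment a b

/-! ### Simultaneous insertion -/

theorem PlanarGraph.mem_segs_insert {G : PlanarGraph} {I : Set Circ} {S : Set (Sym2 Plane)}
    {t : Sym2 Plane} :
    t ∈ (G.insert I S).segs ↔ (t ∈ G.segs ∧ t ∉ S) ∨ ∃ s ∈ S, IsHalf t s := by
  constructor
  · rintro (h | ⟨a, b, h, ht⟩)
    · exact Or.inl h
    · exact Or.inr ⟨_, h, a, b, rfl, ht⟩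
  · rintro (h | ⟨_, h, a, b, rfl, ht⟩)
    · exact Or.inl h
    · exact Or.inr ⟨a, b, h, ht⟩

theorem PlanarGraph.segs_insert_empty (G : PlanarGraph) (I : Set Circ) :
    (G.insert I ∅).segs = G.segs := by
  ext t
  simp [PlanarGraph.mem_segs_insert]

theorem PlanarGraph.insert_insert_center (G : PlanarGraph) (I : Set Circ) (c : Circ) :
    (G.insert I ∅).insert {c} ∅ = G.insert (Insert.insert c I) ∅ := by
  ext t
  · simp only [PlanarGraph.insert, Set.mem_union, Set.image_insert_eq, Set.image_singleton,
      Set.image_empty, Set.mem_insert_iff, Set.mem_singleton_iff, Set.mem_empty_iff_false]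
    tauto
  · simp only [PlanarGraph.segs_insert_empty]

/-- Were `s` a half created by splitting `S`, the second insertion would remove it while the
simultaneous one keeps it; `hs` rules this out. -/
theorem PlanarGraph.insert_insert_midpoint (G : PlanarGraph) (I : Set Circ)
    {S : Set (Sym2 Plane)} {s : Sym2 Plane} (hs : ∀ t ∈ S, ¬ IsHalf s t) :
    (G.insert I S).insert ∅ {s} = G.insert I (Insert.insert s S) := by
  ext t
  · simp only [PlanarGraph.insert, Set.mem_union, Set.image_insert_eq, Set.image_singleton,
      Set.image_empty, Set.mem_insert_iff, Set.mem_singleton_iff, Set.mem_empty_iff_false]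
    tauto
  · simp only [PlanarGraph.mem_segs_insert, Set.mem_singleton_iff, exists_eq_left,
      Set.mem_insert_iff, exists_eq_or_imp]
    constructor
    · rintro (⟨⟨h, h'⟩ | h, hts⟩ | h)
      · exact Or.inl ⟨h, not_or.2 ⟨hts, h'⟩⟩
      · exact Or.inr (Or.inr h)
      · exact Or.inr (Or.inl h)
    · rintro (⟨h, h'⟩ | h | ⟨u, hu, h⟩)
      · exact Or.inl ⟨Or.inl ⟨h, fun hS => h' (Or.inr hS)⟩, fun hts => h' (Or.inl hts)⟩
      · exact Or.inr h
      · exact Or.inl ⟨Or.inr ⟨u, hu, h⟩, fun hts => hs u hu (hts ▸ h)⟩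

theorem PlanarGraph.insert_empty_empty (G : PlanarGraph) : G.insert ∅ ∅ = G := by
  ext t <;> simp [PlanarGraph.insert]

/-- Every segment after an insertion stems from a segment before it. -/
theorem PlanarGraph.exists_parent {G : PlanarGraph} {I : Set Circ} {S : Set (Sym2 Plane)}
    (hS : S ⊆ G.segs) {t : Sym2 Plane} (ht : t ∈ (G.insert I S).segs) :
    ∃ s ∈ G.segs, (t = s ∧ s ∉ S) ∨ (s ∈ S ∧ IsHalf t s) := by
  rcases PlanarGraph.mem_segs_insert.1 ht with ⟨h, h'⟩ | ⟨s, h, h'⟩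
  · exact ⟨t, h, Or.inl ⟨rfl, h'⟩⟩
  · exact ⟨s, hS h, Or.inr ⟨h, h'⟩⟩

/-- Two distinct segments after an insertion stem from distinct segments, or are the halves of the
same segment. -/
theorem PlanarGraph.exists_parents {G : PlanarGraph} {I : Set Circ} {S : Set (Sym2 Plane)}
    (hS : S ⊆ G.segs) {t t' : Sym2 Plane} (ht : t ∈ (G.insert I S).segs)
    (ht' : t' ∈ (G.insert I S).segs) (hne : t ≠ t') :
    (∃ s ∈ G.segs, ∃ s' ∈ G.segs, s ≠ s' ∧ (t = s ∨ IsHalf t s) ∧ (t' = s' ∨ IsHalf t' s')) ∨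
      ∃ s ∈ G.segs, IsHalf t s ∧ IsHalf t' s := by
  obtain ⟨s, hs, h⟩ := PlanarGraph.exists_parent hS ht
  obtain ⟨s', hs', h'⟩ := PlanarGraph.exists_parent hS ht'
  by_cases hss : s = s'
  · subst hss
    rcases h with ⟨rfl, h⟩ | ⟨h, h1⟩ <;> rcases h' with ⟨rfl, h'⟩ | ⟨h', h1'⟩
    · exact absurd rfl hne
    · exact absurd h' h
    · exact absurd h h'
    · exact Or.inr ⟨s, hs, h1, h1'⟩
  · exact Or.inl ⟨s, hs, s', hs', hss, h.imp And.left And.right, h'.imp And.left And.right⟩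

theorem segCarrier_subset_of_parent {t s : Sym2 Plane} (h : t = s ∨ IsHalf t s) :
    segCarrier t ⊆ segCarrier s :=
  h.elim (fun h => h ▸ subset_rfl) IsHalf.segCarrier_subset

theorem encroaches_of_parent {t s : Sym2 Plane} (h : t = s ∨ IsHalf t s) {p : Plane}
    (hp : Encroaches p t) : Encroaches p s :=
  h.elim (fun h => h ▸ hp) fun h => h.encroaches hp

theorem mem_of_parent {t s : Sym2 Plane} (h : t = s ∨ IsHalf t s) {x : Plane}
    (hx : x ∈ s) (hxt : x ∈ segCarrier t) : x ∈ t :=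
  h.elim (fun h => h ▸ hx) fun h => h.mem_of_mem_segCarrier hx hxt

theorem mem_segCarrier_of_mem {s : Sym2 Plane} {x : Plane} (hx : x ∈ s) : x ∈ segCarrier s := by
  induction s with
  | _ a b =>
    rcases Sym2.mem_iff.1 hx with rfl | rfl
    · exact left_mem_segment ℝ _ _
    · exact right_mem_segment ℝ _ _

theorem PlanarGraph.finite_verts_insert {G : PlanarGraph} {I : Set Circ} {S : Set (Sym2 Plane)}
    (hG : G.verts.Finite) (hI : I.Finite) (hS : S.Finite) : (G.insert I S).verts.Finite :=
  (hG.union (hI.image _)).union (hS.image _)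

theorem PlanarGraph.finite_segs_insert {G : PlanarGraph} {S : Set (Sym2 Plane)}
    (hG : G.segs.Finite) (I : Set Circ) (hS : S.Finite) : (G.insert I S).segs.Finite := by
  refine (hG.subset Set.sdiff_subset).union ?_
  -- Each unordered pair has at most two orderings, and each ordering gives one half.
  have h : {p : Plane × Plane | s(p.1, p.2) ∈ S}.Finite := by
    refine hS.preimage' (f := fun p : Plane × Plane => s(p.1, p.2)) fun s _ => ?_
    induction s with
    | _ a b =>
      refine (Set.toFinite {(a, b), (b, a)}).subset ?_
      rintro ⟨x, y⟩ hxy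
      simpa [Sym2.eq_iff] using hxy
  refine (h.image fun p => s(p.1, midpoint ℝ p.1 p.2)).subset ?_
  rintro _ ⟨a, b, hab, rfl⟩
  exact ⟨(a, b), hab, rfl⟩

theorem PlanarGraph.segRad_pos_insert {G : PlanarGraph} {I : Set Circ} {S : Set (Sym2 Plane)}
    (hG : ∀ s ∈ G.segs, 0 < segRad s) (hS : S ⊆ G.segs) :
    ∀ s ∈ (G.insert I S).segs, 0 < segRad s := by
  intro t ht
  obtain ⟨s, hs, ⟨rfl, -⟩ | ⟨-, h⟩⟩ := PlanarGraph.exists_parent hS ht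
  · exact hG _ hs
  · rw [h.segRad_eq]
    exact half_pos (hG s hs)

/-! ### The invariant of preprocessing -/

/-- Distinct segments meet only in common endpoints, and a segment incident to another one has no
point inside the diametral circle of the latter. -/
structure PlanarGraph.IncidenceSeparated (G : PlanarGraph) : Prop where
  finite_verts : G.verts.Finite
  finite_segs : G.segs.Finite
  segRad_pos : ∀ s ∈ G.segs, 0 < segRad s
  seg_inter : ∀ s ∈ G.segs, ∀ t ∈ G.segs, s ≠ t →
    ∀ x, x ∈ segCarrier s → x ∈ segCarrier t → x ∈ s ∧ x ∈ t
  not_encroaches : ∀ s ∈ G.segs, ∀ t ∈ G.segs, s ≠ t → Incident s t →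
    ∀ x ∈ segCarrier t, ¬ Encroaches x s

theorem not_encroaches_of_angle {v a b x : Plane}
    (h : Real.pi / 2 ≤ EuclideanGeometry.angle a v b) (hx : x ∈ segment ℝ v b) :
    ¬ Encroaches x s(v, a) := by
  -- The angle is not acute, so the ray from `v` towards `b` stays in the half-plane beyond the
  -- tangent at `v` to the diametral circle.
  have h1 : inner ℝ (a - v) (b - v) ≤ 0 := by
    rw [← InnerProductGeometry.cos_angle_mul_norm_mul_norm]
    refine mul_nonpos_of_nonpos_of_nonneg ?_ (by positivity)
    refine Real.cos_nonpos_of_pi_div_two_le_of_le h ?_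
    linarith [EuclideanGeometry.angle_le_pi a v b, Real.pi_pos,
      InnerProductGeometry.angle_le_pi (a - v) (b - v)]
  rw [segment_eq_image'] at hx
  obtain ⟨r, ⟨hr, -⟩, rfl⟩ := hx
  rw [encroaches_mk_iff, not_lt]
  have h2 : v + r • (b - v) - v = r • (b - v) := by abel
  have h3 : v + r • (b - v) - a = r • (b - v) - (a - v) := by abel
  rw [h2, h3, inner_sub_right, real_inner_smul_left, real_inner_smul_left,
    real_inner_smul_right, real_inner_self_eq_norm_sq]
  rw [real_inner_comm] at h1
  have h4 := mul_nonpos_of_nonneg_of_nonpos hr h1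
  have h5 : 0 ≤ r * (r * ‖b - v‖ ^ 2) := by positivity
  linarith

theorem PlanarGraph.IsPSLG.incidenceSeparated {G : PlanarGraph} (hG : G.IsPSLG)
    (hangle : G.RightAngled) : G.IncidenceSeparated where
  finite_verts := hG.finite_verts
  finite_segs := hG.finite_segs
  segRad_pos s hs := by
    have h := hG.not_diag s hs
    induction s with
    | _ a b => exact half_pos (dist_pos.2 (by simpa using h))
  seg_inter := hG.seg_inter
  not_encroaches := by
    rintro s hs t ht hne ⟨v, hvs, hvt⟩ x hx
    obtain ⟨a, rfl⟩ := hvs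
    obtain ⟨b, rfl⟩ := hvt
    exact not_encroaches_of_angle (hangle v a b hs ht fun h => hne (by rw [h])) hx

theorem PlanarGraph.IncidenceSeparated.insert {G : PlanarGraph} (hG : G.IncidenceSeparated)
    {S : Set (Sym2 Plane)} (hS : S ⊆ G.segs) : (G.insert ∅ S).IncidenceSeparated where
  finite_verts := G.finite_verts_insert hG.finite_verts Set.finite_empty (hG.finite_segs.subset hS)
  finite_segs := G.finite_segs_insert hG.finite_segs ∅ (hG.finite_segs.subset hS)
  segRad_pos := G.segRad_pos_insert hG.segRad_pos hS
  seg_inter := by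
    intro t ht t' ht' hne x hx hx'
    obtain ⟨s, hs, s', hs', hss, h, h'⟩ | ⟨s, -, h, h'⟩ :=
      PlanarGraph.exists_parents hS ht ht' hne
    · obtain ⟨h1, h2⟩ := hG.seg_inter s hs s' hs' hss x (segCarrier_subset_of_parent h hx)
        (segCarrier_subset_of_parent h' hx')
      exact ⟨mem_of_parent h h1 hx, mem_of_parent h' h2 hx'⟩
    · exact h.mem_of_mem_segCarrier_opposite h' hne hx hx'
  not_encroaches := by
    rintro t ht t' ht' hne ⟨v, hv, hv'⟩ x hx
    obtain ⟨s, hs, s', hs', hss, h, h'⟩ | ⟨s, -, h, h'⟩ :=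
      PlanarGraph.exists_parents hS ht ht' hne
    -- A vertex shared by pieces of distinct parents is an endpoint of both parents, so the parents
    -- are already incident. This is why `seg_inter` belongs to the invariant.
    · have h1 := hG.seg_inter s hs s' hs' hss v
        (segCarrier_subset_of_parent h (mem_segCarrier_of_mem hv))
        (segCarrier_subset_of_parent h' (mem_segCarrier_of_mem hv'))
      exact fun he => hG.not_encroaches s hs s' hs' hss ⟨v, h1⟩ x
        (segCarrier_subset_of_parent h' hx) (encroaches_of_parent h he)
    · exact h.not_encroaches h' hne hx

theorem PreprocessingState.incidenceSeparated {Ω G : PlanarGraph} (h : PreprocessingState Ω G)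
    (hΩ : Ω.IncidenceSeparated) : G.IncidenceSeparated := by
  induction h with
  | start => exact hΩ
  | split _ _ ih => exact ih.insert fun s hs => hs.1

/-! ### The invariant of refinement -/

/-- No point of a segment and no vertex is inside the diametral circle of another segment. -/
structure PlanarGraph.WellSeparated (G : PlanarGraph) : Prop where
  finite_verts : G.verts.Finite
  finite_segs : G.segs.Finite
  segRad_pos : ∀ s ∈ G.segs, 0 < segRad s
  seg_not_encroaches : ∀ s ∈ G.segs, ∀ t ∈ G.segs, s ≠ t →
    ∀ x ∈ segCarrier t, ¬ Encroaches x s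
  vert_not_encroaches : ∀ s ∈ G.segs, ∀ v ∈ G.verts, ¬ Encroaches v s

theorem PlanarGraph.IncidenceSeparated.wellSeparated {G : PlanarGraph}
    (hG : G.IncidenceSeparated) (hbad : badSegs G = ∅) : G.WellSeparated where
  finite_verts := hG.finite_verts
  finite_segs := hG.finite_segs
  segRad_pos := hG.segRad_pos
  seg_not_encroaches := by
    intro s hs t ht hne x hx he
    by_cases h : Incident s t
    · exact hG.not_encroaches s hs t ht hne h x hx he
    · exact (Set.eq_empty_iff_forall_notMem.1 hbad s)
        ⟨hs, Or.inr ⟨t, ht, h, x, hx, Metric.mem_closedBall.2 he.le⟩⟩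
  vert_not_encroaches := by
    intro s hs v hv he
    by_cases h : v ∈ s
    · exact not_encroaches_of_mem h he
    · exact (Set.eq_empty_iff_forall_notMem.1 hbad s)
        ⟨hs, Or.inl ⟨v, hv, h, Metric.mem_closedBall.2 he.le⟩⟩

theorem PlanarGraph.WellSeparated.insert {G : PlanarGraph} (hG : G.WellSeparated)
    {I : Set Circ} {S : Set (Sym2 Plane)} (hS : S ⊆ G.segs) (hI : I.Finite)
    (hc : ∀ c ∈ I, ∀ s ∈ G.segs, ¬ Encroaches c.center s) : (G.insert I S).WellSeparated where
  finite_verts := G.finite_verts_insert hG.finite_verts hI (hG.finite_segs.subset hS)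
  finite_segs := G.finite_segs_insert hG.finite_segs I (hG.finite_segs.subset hS)
  segRad_pos := G.segRad_pos_insert hG.segRad_pos hS
  seg_not_encroaches := by
    intro t ht t' ht' hne x hx
    obtain ⟨s, hs, s', hs', hss, h, h'⟩ | ⟨s, -, h, h'⟩ :=
      PlanarGraph.exists_parents hS ht ht' hne
    · exact fun he => hG.seg_not_encroaches s hs s' hs' hss x
        (segCarrier_subset_of_parent h' hx) (encroaches_of_parent h he)
    · exact h.not_encroaches h' hne hx
  vert_not_encroaches := by
    intro t ht v hv he
    obtain ⟨s, hs, h⟩ := PlanarGraph.exists_parent hS ht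
    have he' := encroaches_of_parent (h.imp And.left And.right) he
    rcases hv with (hv | ⟨c, hcI, rfl⟩) | ⟨s', hs', rfl⟩
    · exact hG.vert_not_encroaches s hs v hv he'
    · exact hc c hcI s hs he'
    · by_cases hss : s = s'
      · subst hss
        rcases h with ⟨-, h⟩ | ⟨-, h⟩
        · exact h hs'
        -- The new midpoint lies exactly on the diametral circles of its two halves.
        · rw [Encroaches, dist_comm, h.dist_segMid, h.segRad_eq] at he
          exact lt_irrefl _ he
      · exact hG.seg_not_encroaches s hs s' (hS hs') hss _ (segMid_mem_segCarrier s') he'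

/-- The midpoint of a half lies strictly inside the diametral circle of the whole. This supplies the
side condition of `PlanarGraph.insert_insert_midpoint`. -/
theorem PlanarGraph.WellSeparated.not_isHalf {G : PlanarGraph} (hG : G.WellSeparated)
    {s t : Sym2 Plane} (hs : s ∈ G.segs) (ht : t ∈ G.segs) : ¬ IsHalf s t := by
  intro h
  have hpos := hG.segRad_pos t ht
  have hrad := h.segRad_eq
  have hne : t ≠ s := by
    rintro rfl
    linarith
  refine hG.seg_not_encroaches t ht s hs hne (segMid s) (segMid_mem_segCarrier s) ?_
  rw [Encroaches, h.dist_segMid]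
  linarith

/-! ### Poorly shaped triangles under insertion of vertices -/

theorem finite_setC (q : Quality) (β : ℝ) {G : PlanarGraph} (hG : G.verts.Finite) :
    (setC q β G).Finite := by
  have h : {f : Fin 3 → Plane | ∀ i, f i ∈ G.verts}.Finite := Set.Finite.pi' fun _ => hG
  have h' : {t : Affine.Triangle ℝ Plane | ∀ i, t.points i ∈ G.verts}.Finite := by
    refine h.preimage (f := fun t : Affine.Triangle ℝ Plane => t.points) ?_
    intro t _ t' _ htt
    exact Affine.Simplex.ext fun i => congrFun htt i
  refine (h'.image fun t => (⟨t.circumcenter, t.circumradius⟩ : Circ)).subset ?_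
  rintro c ⟨⟨t, ht, -, rfl⟩, -⟩
  exact ⟨t, ht.1, rfl⟩

/-- The closest pair of points is a Delaunay edge. -/
theorem exists_isDelaunayEdge_dist_le {P : Set Plane} (hP : P.Finite) {x y : Plane} (hx : x ∈ P)
    (hy : y ∈ P) (hxy : x ≠ y) : ∃ a b, IsDelaunayEdge P a b ∧ dist a b ≤ dist x y := by
  have hfin : {p : Plane × Plane | (p.1 ∈ P ∧ p.2 ∈ P) ∧ p.1 ≠ p.2}.Finite :=
    (hP.prod hP).subset fun p hp => hp.1
  obtain ⟨⟨a, b⟩, ⟨⟨ha, hb⟩, hab⟩, hmin⟩ :=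
    Set.exists_min_image _ (fun p : Plane × Plane => dist p.1 p.2) hfin ⟨(x, y), ⟨hx, hy⟩, hxy⟩
  refine ⟨a, b, ⟨ha, hb, hab, midpoint ℝ a b, ?_, ?_⟩, hmin (x, y) ⟨⟨hx, hy⟩, hxy⟩⟩
  · rw [dist_left_midpoint, dist_right_midpoint]
  · intro z hz hlt
    have hda : dist a (midpoint ℝ a b) = dist a b / 2 := by
      rw [dist_left_midpoint]; norm_num; ring
    by_cases hza : z = a
    · subst hza
      exact lt_irrefl _ hlt
    -- A point inside the diametral circle of the closest pair would be closer to `a` than `b` is.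
    · have h1 := hmin (z, a) ⟨⟨hz, ha⟩, hza⟩
      have h2 := dist_triangle_right z a (midpoint ℝ a b)
      simp only at h1
      linarith

/-- For Chew's notion, the witnessing edge may cease to be Delaunay, but then a Delaunay edge at
most as long replaces it. -/
theorem Poor.mono {q : Quality} {β : ℝ} {P Q : Set Plane} {t : Affine.Triangle ℝ Plane}
    (hPQ : P ⊆ Q) (hQ : Q.Finite) (h : Poor q β P t) : Poor q β Q t := by
  cases q with
  | ruppert => exact h
  | chew =>
    obtain ⟨x, y, ⟨hx, hy, hxy, -⟩, hlt⟩ := h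
    obtain ⟨a, b, hab, hle⟩ := exists_isDelaunayEdge_dist_le hQ (hPQ hx) (hPQ hy) hxy
    refine ⟨a, b, hab, hlt.trans_le ?_⟩
    exact div_le_div_of_nonneg_left t.circumradius_nonneg (dist_pos.2 hab.2.2.1) hle

theorem mem_setC_insert {q : Quality} {β : ℝ} {G : PlanarGraph} (hG : G.verts.Finite)
    {I : Set Circ} (hI : I.Finite) {c : Circ} (hc : c ∈ setC q β G)
    (h : ∀ d ∈ I, ¬ dist d.center c.center < c.radius) : c ∈ setC q β (G.insert I ∅) := by
  obtain ⟨⟨t, ht, hpoor, rfl⟩, hseg⟩ := hc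
  have hsub : G.verts ⊆ (G.insert I ∅).verts := fun x hx => Or.inl (Or.inl hx)
  refine ⟨⟨t, ⟨fun i => hsub (ht.1 i), ?_⟩, ?_, rfl⟩, ?_⟩
  · rintro x ((hx | ⟨d, hd, rfl⟩) | ⟨_, hs, -⟩)
    · exact ht.2 x hx
    · exact h d hd
    · exact absurd hs (Set.notMem_empty _)
  · exact hpoor.mono hsub (G.finite_verts_insert hG hI Set.finite_empty)
  · rwa [PlanarGraph.segs_insert_empty]

/-! ### Sequential simulation of a parallel round -/

theorem SequentialState.encroachedBy_subset {q : Quality} {β : ℝ} {Ω G : PlanarGraph}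
    {D : Set (Sym2 Plane)} (h : SequentialState q β Ω G D) :
    encroachedBy G (setB q β G) ⊆ D := by
  cases h with
  | start => exact subset_rfl
  | insertCenter => exact Set.subset_union_right
  | insertMidpoint => exact Set.subset_union_right

/-- Independent circumcenters can be inserted one by one, by decreasing circumradius. -/
theorem SequentialState.insert_centers {q : Quality} {β : ℝ} {Ω G : PlanarGraph}
    {D T : Set (Sym2 Plane)} (h : SequentialState q β Ω G D) (hG : G.verts.Finite)
    (hTD : T ⊆ D) (hTG : T ⊆ G.segs) (I : Finset Circ) (hI : (I : Set Circ) ⊆ setC q β G)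
    (hind : (I : Set Circ).Pairwise fun c d => ¬ Conflict c d) :
    ∃ D', SequentialState q β Ω (G.insert I ∅) D' ∧ T ⊆ D' := by
  classical
  -- The circle of least radius is inserted last.
  induction I using Finset.induction_on_min_value (f := Circ.radius) with
  | empty => exact ⟨D, by rwa [Finset.coe_empty, G.insert_empty_empty], hTD⟩
  | insert c I hcI hmin ih =>
    rw [Finset.coe_insert] at hI hind ⊢
    obtain ⟨D', h', hD'⟩ := ih ((Set.subset_insert _ _).trans hI)
      (hind.mono (Set.subset_insert _ _))
    have hc : c ∈ setC q β (G.insert I ∅) := by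
      refine mem_setC_insert hG I.finite_toSet (hI (Set.mem_insert _ _)) fun d hd hlt => ?_
      have hne : d ≠ c := by
        rintro rfl
        exact hcI hd
      exact hind (Set.mem_insert_of_mem _ hd) (Set.mem_insert _ _) hne
        ⟨hlt.trans_le (hmin d hd), hlt⟩
    refine ⟨_, h'.insertCenter hc (G.insert_insert_center I c).symm, ?_⟩
    intro s hs
    refine Or.inl ⟨hD' hs, ?_⟩
    rw [PlanarGraph.segs_insert_empty]
    exact hTG hs

/-- Segments of `𝓓_𝓑` can be split one by one. -/
theorem SequentialState.insert_midpoints {q : Quality} {β : ℝ} {Ω G : PlanarGraph} {I : Set Circ}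
    {D T : Set (Sym2 Plane)} (h : SequentialState q β Ω (G.insert I ∅) D) (hG : G.WellSeparated)
    (hTD : T ⊆ D) (hTG : T ⊆ G.segs) (S : Finset (Sym2 Plane))
    (hS : (S : Set (Sym2 Plane)) ⊆ T) :
    ∃ D', SequentialState q β Ω (G.insert I S) D' ∧ T \ S ⊆ D' := by
  classical
  induction S using Finset.induction_on with
  | empty => exact ⟨D, by rwa [Finset.coe_empty], Set.sdiff_subset.trans hTD⟩
  | insert s S hsS ih =>
    rw [Finset.coe_insert] at hS ⊢
    obtain ⟨D', h', hD'⟩ := ih ((Set.subset_insert _ _).trans hS)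
    have hs : s ∈ T := hS (Set.mem_insert _ _)
    have hG' : G.insert I (Insert.insert s (S : Set (Sym2 Plane))) =
        (G.insert I S).insert ∅ {s} :=
      (G.insert_insert_midpoint I fun t ht => hG.not_isHalf (hTG hs)
        (hTG (hS (Set.mem_insert_of_mem _ ht)))).symm
    refine ⟨_, h'.insertMidpoint (Or.inr (hD' ⟨hs, hsS⟩)) hG', ?_⟩
    rintro t ⟨ht, htS⟩
    refine Or.inl ⟨hD' ⟨ht, fun h => htS (Set.mem_insert_of_mem _ h)⟩, ?_⟩
    exact PlanarGraph.mem_segs_insert.2 (Or.inl ⟨hTG ht, htS⟩)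

/-- Circles of `𝓒` encroach nothing, so only those of `𝓑` contribute segments. -/
theorem encroachedBy_subset_setB {q : Quality} {β : ℝ} {G : PlanarGraph} {X : Set Circ}
    (hX : X ⊆ setB q β G ∪ setC q β G) : encroachedBy G X ⊆ encroachedBy G (setB q β G) := by
  rintro s ⟨hs, c, hc, he⟩
  rcases hX hc with h | h
  · exact ⟨hs, c, h, he⟩
  · exact absurd ⟨s, hs, he⟩ h.2

theorem ParallelState.wellSeparated_and_sequentialState {q : Quality} {β : ℝ}
    {Ω G : PlanarGraph} (h : ParallelState q β Ω G) (hΩ : Ω.WellSeparated) :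
    G.WellSeparated ∧ ∃ D, SequentialState q β Ω G D := by
  induction h with
  | start => exact ⟨hΩ, _, SequentialState.start⟩
  | @round G X I S _ hX _ hI ih =>
    obtain ⟨hG, D, hD⟩ := ih
    have hIC : I ⊆ setC q β G := fun c hc => (hI.centers_subset hc).2
    have hIfin : I.Finite := (finite_setC q β hG.finite_verts).subset hIC
    have hSG : S ⊆ G.segs := fun s hs => (hI.segs_subset hs).1
    have hSfin : S.Finite := hG.finite_segs.subset hSG
    have hSD : S ⊆ D := (hI.segs_subset.trans (encroachedBy_subset_setB hX.subset)).trans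
      hD.encroachedBy_subset
    refine ⟨hG.insert hSG hIfin fun c hc s hs he => (hIC hc).2 ⟨s, hs, he⟩, ?_⟩
    lift I to Finset Circ using hIfin
    lift S to Finset (Sym2 Plane) using hSfin
    obtain ⟨D₁, h₁, hS₁⟩ := hD.insert_centers hG.finite_verts hSD hSG I hIC hI.independent
    obtain ⟨D₂, h₂, -⟩ := h₁.insert_midpoints hG hS₁ hSG S subset_rfl
    exact ⟨D₂, h₂⟩

theorem setB_union_setC (q : Quality) (β : ℝ) (G : PlanarGraph) :
    setB q β G ∪ setC q β G = poorCircles q β G := by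
  ext c
  exact (and_or_left.symm.trans (and_iff_left (em _)))

/-- Any chosen circle yields a candidate: itself if in `𝓒`, an encroached segment if in `𝓑`. -/
theorem IsChoiceBC.poorCircles_eq_empty {q : Quality} {β : ℝ} {G : PlanarGraph} {X : Set Circ}
    (hX : IsChoiceBC q β G X) (hC : X ∩ setC q β G = ∅) (hD : encroachedBy G X = ∅) :
    poorCircles q β G = ∅ := by
  rw [← setB_union_setC, ← Set.not_nonempty_iff_eq_empty]
  intro hne
  obtain ⟨c, hc⟩ := hX.nonempty hne
  rcases hX.subset hc with h | h
  · obtain ⟨-, s, hs, he⟩ := h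
    exact Set.eq_empty_iff_forall_notMem.1 hD s ⟨hs, c, hc, he⟩
  · exact Set.eq_empty_iff_forall_notMem.1 hC c ⟨hc, h⟩

end DelaunayRefinement

open DelaunayRefinement
theorem mainTheorem6 (q : Quality) (β : ℝ) (hβ : √2 ≤ β)
    (Ω Ω' M : PlanarGraph) (hΩ : Ω.IsPSLG) (hangle : Ω.RightAngled)
    (hM : IsParallelOutput q β Ω Ω' M) :
    IsSequentialOutput q β Ω' M ∧
      (∀ t : Affine.Triangle ℝ Plane, IsDelaunayTriangle M.verts t → ¬ Poor q β M.verts t) ∧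
      (∀ s ∈ M.segs, ∀ p ∈ M.verts, ¬ Encroaches p s) := by
  obtain ⟨⟨hpre, hbad⟩, hpar, X, hX, hC, hD⟩ := hM
  have hΩ' : Ω'.WellSeparated :=
    (hpre.incidenceSeparated (hΩ.incidenceSeparated hangle)).wellSeparated hbad
  obtain ⟨hsep, hseq⟩ := hpar.wellSeparated_and_sequentialState hΩ'
  have hpoor := hX.poorCircles_eq_empty hC hD
  have hBC := Set.union_empty_iff.1 ((setB_union_setC q β M).trans hpoor)
  refine ⟨⟨hseq, hBC.2, ?_, hBC.1⟩, ?_, hsep.vert_not_encroaches⟩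
  · refine Set.eq_empty_iff_forall_notMem.2 ?_
    rintro s ⟨hs, p, hp, he⟩
    exact hsep.vert_not_encroaches s hs p hp he
  · exact fun t ht hp => Set.eq_empty_iff_forall_notMem.1 hpoor _ ⟨t, ht, hp, rfl⟩
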